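/- Let $\mathbf{t} : \mathcal{D} \to \mathcal{T}$ be a logical refinement system: $\mathcal{D}$ and $\mathcal{T}$ are monoidal categories with partially defined left and right residuals, $\mathbf{t}$ is a strict monoidal functor, and whenever a residual is defined in $\mathcal{D}$, the corresponding residual is defined in $\mathcal{T}$ and $\mathbf{t}$ maps the former (object and evaluation map) strictly to the latter. Here a left residual $X\backslash Z$ is an object with an evaluation map $X\otimes (X\backslash Z)\to Z$ through which every $f : X\otimes Y\to Z$ factors by a unique $\lambda[f] : Y \to X\backslash Z$; right residuals $Z/Y$, with evaluation $(Z/Y)\otimes Y\to Z$ and curryings $\rho[f] : X\to Z/Y$, are defined symmetrically. Let $(W,p,e)$ be a monoid in $\mathcal{T}$, with multiplication $p : W\otimes W\to W$, and let $\mathcal{D}_W$ be the fiber of $\mathbf{t}$ over $W$. For $P,Q,R\in\mathcal{D}_W$ put $$P \multimap_W R := \lambda[p]^*(P\backslash R),\qquad R \mathbin{\circ\!\!-}_W Q := \rho[p]^*(R/Q),$$ whenever the residuals $P\backslash R$ (over $W\backslash W$) and $R/Q$ (over $W/W$) are defined and have these pullbacks, where a pullback $c^*S$ of $S$ along $c :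 A\to \mathbf{t}(S)$ is an object over $A$ with a (strongly) cartesian morphism $c^*S\to S$ over $c$. Let $W^+$ be the category whose objects are pairs $(X,c)$ with $X\in\mathcal{D}$ and $c : \mathbf{t}(X)\to W$, and whose morphisms $(X_1,c_1)\to(X_2,c_2)$ are morphisms $\alpha : X_1\to X_2$ with $c_1 = c_2\circ \mathbf{t}(\alpha)$. It carries the tensor product $(X_1,c_1)\bullet(X_2,c_2) = (X_1\otimes X_2,\ p\circ (c_1\otimes c_2))$. For $Q\in\mathcal{D}_W$ let $Q^+ : (W^+)^{\mathrm{op}}\to\mathbf{Set}$ be the presheaf sending $(X,c)$ to the set of morphisms $X\to Q$ lying over $c$; this defines a functor $(-)^+ : \mathcal{D}_W\to[(W^+)^{\mathrm{op}},\mathbf{Set}]$, acting on morphisms by composition. For presheaves $\phi,\psi,\omega$ on $W^+$ let $\phi\multimap_{W^+}\omega$ and $\omega \mathbin{\circ\!\!-}_{W^+}\psi$ be the presheaves $$x\mapsto \mathrm{Nat}(\phi,\ \omega(-\bullet x)),\qquad x\mapsto \mathrm{Nat}(\psi,\ \omega(x\bullet -)).$$ Then the functor $(-)^+$ preserves residuals: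 for all $P,Q,R\in\mathcal{D}_W$ such that the respective residuals and pullbacks exist, the canonical coercions $$(P\multimap_W R)^+\to P^+\multimap_{W^+}R^+,\qquad (R \mathbin{\circ\!\!-}_W Q)^+\to R^+ \mathbin{\circ\!\!-}_{W^+}Q^+$$ are isomorphisms of presheaves on $W^+$. Here the first coercion sends $\beta : X\to P\multimap_W R$ to the transformation taking $\alpha : Y\to P$ to the composite $Y\otimes X\to P\otimes(P\backslash R)\to R$ of $\alpha\otimes\beta$, the cartesian morphism $P\multimap_W R\to P\backslash R$, and evaluation; the second is defined symmetrically. -/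

import Mathlib

open CategoryTheory MonoidalCategory Functor.LaxMonoidal Functor.OplaxMonoidal

universe w v₁ v₂ u₁ u₂

namespace Refinement

section Residuals

variable {C : Type u₁} [Category.{v₁} C] [MonoidalCategory C]

/-- A left residual `X \ Z`: an object with an evaluation `X ⊗ (X \ Z) ⟶ Z` through which every
`f : X ⊗ Y ⟶ Z` factors by a unique `curry f : Y ⟶ X \ Z`. -/
structure LeftResidual (X Z : C) where
  obj : C
  plug : X ⊗ obj ⟶ Z
  curry {Y : C} (f : X ⊗ Y ⟶ Z) : Y ⟶ obj
  curry_plug {Y : C} (f : X ⊗ Y ⟶ Z) : X ◁ curry f ≫ plug = f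
  curry_uniq {Y : C} (g : Y ⟶ obj) : curry (X ◁ g ≫ plug) = g

/-- A right residual `Z / Y`: an object with an evaluation `(Z / Y) ⊗ Y ⟶ Z` through which every
`f : X ⊗ Y ⟶ Z` factors by a unique `curry f : X ⟶ Z / Y`. -/
structure RightResidual (Z Y : C) where
  obj : C
  plug : obj ⊗ Y ⟶ Z
  curry {X : C} (f : X ⊗ Y ⟶ Z) : X ⟶ obj
  curry_plug {X : C} (f : X ⊗ Y ⟶ Z) : curry f ▷ Y ≫ plug = f
  curry_uniq {X : C} (g : X ⟶ obj) : curry (g ▷ Y ≫ plug) = g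

variable (C) in
/-- Partial residuation operations on a monoidal category: `HasLeft X Z` (resp. `HasRight Z Y`) says
that `X \ Z` (resp. `Z / Y`) is defined. -/
class PartialResiduation where
  HasLeft : C → C → Prop
  left {X Z : C} : HasLeft X Z → LeftResidual X Z
  HasRight : C → C → Prop
  right {Z Y : C} : HasRight Z Y → RightResidual Z Y

end Residuals

open PartialResiduation

section Fibers

variable {D : Type u₁} [Category.{v₁} D] {T : Type u₂} [Category.{v₂} T]

/-- The object of `D` underlying a refinement of `A`. -/
abbrev carrier {t : D ⥤ T} {A : T} (P : t.Fiber A) : D := Functor.Fiber.fiberInclusion.obj P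

lemma obj_carrier {t : D ⥤ T} {A : T} (P : t.Fiber A) : t.obj (carrier P) = A := P.2

/-- A pullback of the refinement `Q` along `c : A ⟶ B`: a refinement of `A` with a strongly
cartesian morphism to `Q` lying over `c`. -/
structure Pullback (t : D ⥤ T) {A B : T} (c : A ⟶ B) (Q : D) where
  obj : t.Fiber A
  map : carrier obj ⟶ Q
  cartesian : t.IsStronglyCartesian c map

end Fibers

section Systems

variable {D : Type u₁} [Category.{v₁} D] [MonoidalCategory D]
  {T : Type u₂} [Category.{v₂} T] [MonoidalCategory T]

/-- A monoidal refinement system: a functor that strictly preserves tensor products and the unit,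
that is, a monoidal functor whose structure maps are identities. -/
class MonoidalRefinementSystem (t : D ⥤ T) [t.Monoidal] : Prop where
  obj_tensor (P Q : D) : t.obj P ⊗ t.obj Q = t.obj (P ⊗ Q)
  obj_unit : 𝟙_ T = t.obj (𝟙_ D)
  μ_eq (P Q : D) : μ t P Q = eqToHom (obj_tensor P Q)
  ε_eq : ε t = eqToHom obj_unit

/-- A logical refinement system: a monoidal refinement system that strictly preserves whatever
residuals are defined upstairs (both the objects and the evaluation maps). -/
class LogicalRefinementSystem (t : D ⥤ T) [t.Monoidal] [PartialResiduation D]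
    [PartialResiduation T] : Prop extends MonoidalRefinementSystem t where
  hasLeft {P R : D} : HasLeft P R → HasLeft (t.obj P) (t.obj R)
  left_obj {P R : D} (h : HasLeft P R) : t.obj (left h).obj = (left (hasLeft h)).obj
  left_plug {P R : D} (h : HasLeft P R) : t.IsHomLift (left (hasLeft h)).plug (left h).plug
  hasRight {R Q : D} : HasRight R Q → HasRight (t.obj R) (t.obj Q)
  right_obj {R Q : D} (h : HasRight R Q) : t.obj (right h).obj = (right (hasRight h)).obj
  right_plug {R Q : D} (h : HasRight R Q) : t.IsHomLift (right (hasRight h)).plug (right h).plug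

section Lemmas

variable (t : D ⥤ T) [t.Monoidal]

lemma isHomLift_tensor [MonoidalRefinementSystem t] {P₁ P₂ Q₁ Q₂ : D} {B₁ B₂ : T}
    {c₁ : t.obj P₁ ⟶ B₁} {c₂ : t.obj P₂ ⟶ B₂} {α₁ : P₁ ⟶ Q₁} {α₂ : P₂ ⟶ Q₂}
    (h₁ : t.IsHomLift c₁ α₁) (h₂ : t.IsHomLift c₂ α₂) :
    t.IsHomLift (δ t P₁ P₂ ≫ (c₁ ⊗ₘ c₂)) (α₁ ⊗ₘ α₂) := by
  have e₁ := IsHomLift.codomain_eq t c₁ α₁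
  have e₂ := IsHomLift.codomain_eq t c₂ α₂
  subst e₁ e₂
  obtain rfl := IsHomLift.eq_of_isHomLift t c₁ α₁
  obtain rfl := IsHomLift.eq_of_isHomLift t c₂ α₂
  have h : δ t P₁ P₂ ≫ (t.map α₁ ⊗ₘ t.map α₂) =
      t.map (α₁ ⊗ₘ α₂) ≫ eqToHom (MonoidalRefinementSystem.obj_tensor Q₁ Q₂).symm := by
    have := MonoidalRefinementSystem.μ_eq (t := t) Q₁ Q₂
    rw [← cancel_mono (μ t Q₁ Q₂)]
    simp [this]
    simp [← this]
  rw [h]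
  infer_instance

variable [PartialResiduation D] [PartialResiduation T] [LogicalRefinementSystem t]

lemma hasLeft_of_refines {P R : D} {A C : T} (hP : t.obj P = A) (hR : t.obj R = C)
    (h : HasLeft P R) : HasLeft A C := by
  subst hP hR; exact LogicalRefinementSystem.hasLeft h

lemma hasRight_of_refines {R Q : D} {C B : T} (hR : t.obj R = C) (hQ : t.obj Q = B)
    (h : HasRight R Q) : HasRight C B := by
  subst hQ hR; exact LogicalRefinementSystem.hasRight h

lemma isHomLift_leftPlug {P R : D} {A C : T} (hP : t.obj P = A) (hR : t.obj R = C)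
    (h : HasLeft P R) :
    t.IsHomLift (left (hasLeft_of_refines t hP hR h)).plug (left h).plug := by
  subst hP hR; exact LogicalRefinementSystem.left_plug h

lemma isHomLift_rightPlug {R Q : D} {C B : T} (hR : t.obj R = C) (hQ : t.obj Q = B)
    (h : HasRight R Q) :
    t.IsHomLift (right (hasRight_of_refines t hR hQ h)).plug (right h).plug := by
  subst hQ hR; exact LogicalRefinementSystem.right_plug h

end Lemmas

end Systems

section Presheaves

variable {A B C : Type*} [Category* A] [Category* B] [Category* C]

/-- The left currying `B ⥤ [A, C]` of a functor `A × B ⥤ C`. -/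
def lcurry (F : A × B ⥤ C) : B ⥤ A ⥤ C := Functor.curry.obj (CategoryTheory.Prod.swap B A ⋙ F)

/-- The right currying `A ⥤ [B, C]` of a functor `A × B ⥤ C`. -/
def rcurry (F : A × B ⥤ C) : A ⥤ B ⥤ C := Functor.curry.obj F

/-- Pullback of a presheaf along a functor: precomposition. -/
abbrev pshPullback (F : A ⥤ B) (ψ : Bᵒᵖ ⥤ Type w) : Aᵒᵖ ⥤ Type w := F.op ⋙ ψ

/-- The external residual of presheaves, a presheaf over the functor category `[A, C]`: it sends `F`
to the end `∀ a, φ a → ω (F a)`, that is, to the set of natural transformations from `φ` to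
the pullback of `ω` along `F`. As the tensor product of categories is symmetric, it serves both as the
left residual `φ \ ω` and as the right residual `ω / φ`. -/
def pshResidual (φ : Aᵒᵖ ⥤ Type w) (ω : Cᵒᵖ ⥤ Type w) : (A ⥤ C)ᵒᵖ ⥤ Type _ where
  obj F := φ ⟶ pshPullback F.unop ω
  map f := TypeCat.ofHom fun θ => θ ≫ Functor.whiskerRight (NatTrans.op f.unop) ω

end Presheaves

section Positive

variable {D : Type u₁} [Category.{v₁} D] {T : Type u₂} [Category.{v₂} T]

/-- The relative slice of `B`: objects are pairs `(P, c : t P ⟶ B)`, and morphisms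
`(P₁, c₁) ⟶ (P₂, c₂)` are the `α : P₁ ⟶ P₂` with `c₁ = t α ≫ c₂`. -/
abbrev Slice (t : D ⥤ T) (B : T) := CostructuredArrow t B

/-- The presheaf over the slice of `B` that represents a refinement `Q` of `B`: it sends `(P, c)` to
the set of morphisms `P ⟶ Q` lying over `c` (lifted to a universe that makes the presheaf
category closed). -/
def posPresheaf (t : D ⥤ T) {B : T} (Q : t.Fiber B) :
    (Slice t B)ᵒᵖ ⥤ Type (max u₁ v₁ v₂) where
  obj x := ULift.{max u₁ v₂} {α : x.unop.left ⟶ carrier Q // t.IsHomLift x.unop.hom α}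
  map {x y} f := TypeCat.ofHom fun α => ⟨f.unop.left ≫ α.down.1, by
    have := α.down.2
    rw [← CostructuredArrow.w f.unop]
    infer_instance⟩

/-- The positive representation restricted to the fiber of `W`. -/
def pos (t : D ⥤ T) (W : T) : t.Fiber W ⥤ (Slice t W)ᵒᵖ ⥤ Type (max u₁ v₁ v₂) where
  obj Q := posPresheaf t Q
  map {Q Q'} f :=
    { app x := TypeCat.ofHom fun α => ⟨α.down.1 ≫ Functor.Fiber.fiberInclusion.map f, by
        have := α.down.2
        infer_instance⟩
      naturality x y g := by
        ext α
        apply ULift.ext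
        apply Subtype.ext
        exact Category.assoc _ _ _ }
  map_id Q := by
    ext x α
    apply ULift.ext
    apply Subtype.ext
    exact Category.comp_id _
  map_comp f g := by
    ext x α
    apply ULift.ext
    apply Subtype.ext
    exact (Category.assoc _ _ _).symm

variable [MonoidalCategory D] [MonoidalCategory T] (t : D ⥤ T) [t.Monoidal]

/-- The functor sending `((P₁, c₁), (P₂, c₂))` to `(P₁ ⊗ P₂, c₁ ⊗ c₂)`. -/
def sliceTensor (B₁ B₂ : T) : Slice t B₁ × Slice t B₂ ⥤ Slice t (B₁ ⊗ B₂) where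
  obj x := CostructuredArrow.mk (Y := x.1.left ⊗ x.2.left)
    (δ t x.1.left x.2.left ≫ (x.1.hom ⊗ₘ x.2.hom))
  map {x y} f := CostructuredArrow.homMk (f.1.left ⊗ₘ f.2.left) (by
    have h : (x.1.hom ⊗ₘ x.2.hom) =
        (t.map f.1.left ⊗ₘ t.map f.2.left) ≫ (y.1.hom ⊗ₘ y.2.hom) := by
      rw [MonoidalCategory.tensorHom_comp_tensorHom, CostructuredArrow.w, CostructuredArrow.w]
    change t.map (f.1.left ⊗ₘ f.2.left) ≫ δ t y.1.left y.2.left ≫ (y.1.hom ⊗ₘ y.2.hom) =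
      δ t x.1.left x.2.left ≫ (x.1.hom ⊗ₘ x.2.hom)
    rw [h, δ_natural_assoc])
  map_id x := by ext; simp
  map_comp f g := by ext; simp

/-- The tensor product that the slice of a monoid `W` inherits from `W`. -/
def monoidTensor (W : T) [MonObj W] : Slice t W × Slice t W ⥤ Slice t W :=
  sliceTensor t W W ⋙ CostructuredArrow.map (MonObj.mul : W ⊗ W ⟶ W)

/-- The left residual `φ ⊸ ω` of presheaves over the slice of `W`: the pullback of the external
residual `φ \ ω` along the left currying of the tensor product. -/
def sliceImpL (W : T) [MonObj W] (φ ω : (Slice t W)ᵒᵖ ⥤ Type (max u₁ v₁ v₂)) :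
    (Slice t W)ᵒᵖ ⥤ Type (max u₁ v₁ v₂) :=
  pshPullback (lcurry (monoidTensor t W)) (pshResidual φ ω)

/-- The right residual `ω ⟜ ψ` of presheaves over the slice of `W`: the pullback of the external
residual `ω / ψ` along the right currying of the tensor product. -/
def sliceImpR (W : T) [MonObj W] (ω ψ : (Slice t W)ᵒᵖ ⥤ Type (max u₁ v₁ v₂)) :
    (Slice t W)ᵒᵖ ⥤ Type (max u₁ v₁ v₂) :=
  pshPullback (rcurry (monoidTensor t W)) (pshResidual ψ ω)

variable [PartialResiduation D] [PartialResiduation T] [LogicalRefinementSystem t]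
  {W : T} [MonObj W]

/-- A fiberwise left residual `P ⊸ R` over a monoid `W`: the residual `P \ R` is defined, and its
pullback along the left currying `W ⟶ W \ W` of the multiplication is given. -/
structure LeftImplication (P R : t.Fiber W) where
  hasLeft : HasLeft (carrier P) (carrier R)
  pullback : Pullback t
    ((left (hasLeft_of_refines t (obj_carrier P) (obj_carrier R) hasLeft)).curry
      (MonObj.mul : W ⊗ W ⟶ W))
    (left hasLeft).obj

/-- A fiberwise right residual `R ⟜ Q` over a monoid `W`: the residual `R / Q` is defined, and its
pullback along the right currying `W ⟶ W / W` of the multiplication is given. -/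
structure RightImplication (R Q : t.Fiber W) where
  hasRight : HasRight (carrier R) (carrier Q)
  pullback : Pullback t
    ((right (hasRight_of_refines t (obj_carrier R) (obj_carrier Q) hasRight)).curry
      (MonObj.mul : W ⊗ W ⟶ W))
    (right hasRight).obj

variable {t}

namespace LeftImplication

variable {P R : t.Fiber W} (I : LeftImplication t P R)

/-- The refinement `P ⊸ R` of `W`. -/
abbrev obj : t.Fiber W := I.pullback.obj

/-- From `α : Y ⟶ P` over `d` and `β : X ⟶ (P ⊸ R)` over `c`, the composite
`Y ⊗ X ⟶ P ⊗ (P \ R) ⟶ R` lies over `(d ⊗ c) ≫ mul`. -/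
lemma isHomLift_apply {Y X : D} {d : t.obj Y ⟶ W} {c : t.obj X ⟶ W} {α : Y ⟶ carrier P}
    {β : X ⟶ carrier I.obj} (hα : t.IsHomLift d α) (hβ : t.IsHomLift c β) :
    t.IsHomLift ((δ t Y X ≫ (d ⊗ₘ c)) ≫ MonObj.mul)
      ((α ⊗ₘ (β ≫ I.pullback.map)) ≫ (left I.hasLeft).plug) := by
  have hI := I.pullback.cartesian.toIsHomLift
  have h := isHomLift_leftPlug t (obj_carrier P) (obj_carrier R) I.hasLeft
  have hc := IsHomLift.comp t c ((left (hasLeft_of_refines t (obj_carrier P) (obj_carrier R) I.hasLeft)).curry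
    (MonObj.mul : W ⊗ W ⟶ W)) β I.pullback.map
  have h' := isHomLift_tensor t hα hc
  have e : (d ⊗ₘ c) ≫ MonObj.mul = (d ⊗ₘ (c ≫ (left (hasLeft_of_refines t (obj_carrier P) (obj_carrier R)
      I.hasLeft)).curry (MonObj.mul : W ⊗ W ⟶ W))) ≫ (left (hasLeft_of_refines t (obj_carrier P) (obj_carrier R)
      I.hasLeft)).plug := by
    conv_lhs => rw [← (left (hasLeft_of_refines t (obj_carrier P) (obj_carrier R) I.hasLeft)).curry_plug
      (MonObj.mul : W ⊗ W ⟶ W)]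
    simp [MonoidalCategory.tensorHom_def]
  rw [Category.assoc, e, ← Category.assoc]
  infer_instance

/-- The canonical coercion `pos (P ⊸ R) ⟶ (pos P ⊸ pos R)`: it sends `β : X ⟶ (P ⊸ R)` to the
transformation that takes `α : Y ⟶ P` to the composite `Y ⊗ X ⟶ P ⊗ (P \ R) ⟶ R`. -/
def coercion : (pos t W).obj I.obj ⟶ sliceImpL t W ((pos t W).obj P) ((pos t W).obj R) where
  app x := TypeCat.ofHom fun β =>
    { app y := TypeCat.ofHom fun α =>
        ⟨(α.down.1 ⊗ₘ (β.down.1 ≫ I.pullback.map)) ≫ (left I.hasLeft).plug,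
          I.isHomLift_apply α.down.2 β.down.2⟩
      naturality y z f := by
        ext α
        apply ULift.ext
        apply Subtype.ext
        change ((f.unop.left ≫ α.down.1) ⊗ₘ (β.down.1 ≫ I.pullback.map)) ≫ _ =
          (f.unop.left ⊗ₘ 𝟙 x.unop.left) ≫ (α.down.1 ⊗ₘ (β.down.1 ≫ I.pullback.map)) ≫ _
        rw [MonoidalCategory.tensorHom_comp_tensorHom_assoc, Category.id_comp] }
  naturality x z f := by
    ext β
    apply NatTrans.ext
    ext y α
    apply ULift.ext
    apply Subtype.ext
    change (α.down.1 ⊗ₘ ((f.unop.left ≫ β.down.1) ≫ I.pullback.map)) ≫ _ =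
      (𝟙 y.unop.left ⊗ₘ f.unop.left) ≫ (α.down.1 ⊗ₘ (β.down.1 ≫ I.pullback.map)) ≫ _
    simp only [MonoidalCategory.tensorHom_comp_tensorHom_assoc, Category.id_comp, Category.assoc]

end LeftImplication

namespace RightImplication

variable {R Q : t.Fiber W} (I : RightImplication t R Q)

/-- The refinement `R ⟜ Q` of `W`. -/
abbrev obj : t.Fiber W := I.pullback.obj

/-- From `β : X ⟶ (R ⟜ Q)` over `c` and `α : Y ⟶ Q` over `d`, the composite
`X ⊗ Y ⟶ (R / Q) ⊗ Q ⟶ R` lies over `(c ⊗ d) ≫ mul`. -/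
lemma isHomLift_apply {X Y : D} {c : t.obj X ⟶ W} {d : t.obj Y ⟶ W} {β : X ⟶ carrier I.obj}
    {α : Y ⟶ carrier Q} (hβ : t.IsHomLift c β) (hα : t.IsHomLift d α) :
    t.IsHomLift ((δ t X Y ≫ (c ⊗ₘ d)) ≫ MonObj.mul)
      (((β ≫ I.pullback.map) ⊗ₘ α) ≫ (right I.hasRight).plug) := by
  have hI := I.pullback.cartesian.toIsHomLift
  have h := isHomLift_rightPlug t (obj_carrier R) (obj_carrier Q) I.hasRight
  have hc := IsHomLift.comp t c ((right (hasRight_of_refines t (obj_carrier R) (obj_carrier Q) I.hasRight)).curry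
    (MonObj.mul : W ⊗ W ⟶ W)) β I.pullback.map
  have h' := isHomLift_tensor t hc hα
  have e : (c ⊗ₘ d) ≫ MonObj.mul = ((c ≫ (right (hasRight_of_refines t (obj_carrier R) (obj_carrier Q)
      I.hasRight)).curry (MonObj.mul : W ⊗ W ⟶ W)) ⊗ₘ d) ≫ (right (hasRight_of_refines t (obj_carrier R) (obj_carrier Q)
      I.hasRight)).plug := by
    conv_lhs => rw [← (right (hasRight_of_refines t (obj_carrier R) (obj_carrier Q) I.hasRight)).curry_plug
      (MonObj.mul : W ⊗ W ⟶ W)]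
    simp [MonoidalCategory.tensorHom_def']
  rw [Category.assoc, e, ← Category.assoc]
  infer_instance

/-- The canonical coercion `pos (R ⟜ Q) ⟶ (pos R ⟜ pos Q)`: it sends `β : X ⟶ (R ⟜ Q)` to the
transformation that takes `α : Y ⟶ Q` to the composite `X ⊗ Y ⟶ (R / Q) ⊗ Q ⟶ R`. -/
def coercion : (pos t W).obj I.obj ⟶ sliceImpR t W ((pos t W).obj R) ((pos t W).obj Q) where
  app x := TypeCat.ofHom fun β =>
    { app y := TypeCat.ofHom fun α =>
        ⟨((β.down.1 ≫ I.pullback.map) ⊗ₘ α.down.1) ≫ (right I.hasRight).plug,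
          I.isHomLift_apply β.down.2 α.down.2⟩
      naturality y z f := by
        ext α
        apply ULift.ext
        apply Subtype.ext
        change ((β.down.1 ≫ I.pullback.map) ⊗ₘ (f.unop.left ≫ α.down.1)) ≫ _ =
          (𝟙 x.unop.left ⊗ₘ f.unop.left) ≫ ((β.down.1 ≫ I.pullback.map) ⊗ₘ α.down.1) ≫ _
        rw [MonoidalCategory.tensorHom_comp_tensorHom_assoc, Category.id_comp] }
  naturality x z f := by
    ext β
    apply NatTrans.ext
    ext y α
    apply ULift.ext
    apply Subtype.ext
    change (((f.unop.left ≫ β.down.1) ≫ I.pullback.map) ⊗ₘ α.down.1) ≫ _ =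
      (f.unop.left ⊗ₘ 𝟙 y.unop.left) ≫ ((β.down.1 ≫ I.pullback.map) ⊗ₘ α.down.1) ≫ _
    simp only [MonoidalCategory.tensorHom_comp_tensorHom_assoc, Category.id_comp, Category.assoc]

end RightImplication

end Positive

end Refinement

/-!
By Yoneda, the presheaf of `P` being represented by `(P, id)`, a transformation
`P⁺ ⟶ R⁺(- • x)` with `x = (X, c)` is determined by its value at the identity of `P`: a morphism
`P ⊗ X ⟶ R` lying over `(id ⊗ c) ≫ p`. Currying in `D` and in `T`, which `t` matches up, turns
these into the morphisms `X ⟶ P \ R` lying over `c ≫ λ[p]`, which factor uniquely through the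
pullback of `P \ R` along `λ[p]` as morphisms lying over `c`.
-/

namespace Refinement

section Residuals

variable {C : Type u₁} [Category.{v₁} C] [MonoidalCategory C]

lemma LeftResidual.hom_ext {X Z Y : C} (L : LeftResidual X Z) {g g' : Y ⟶ L.obj}
    (h : X ◁ g ≫ L.plug = X ◁ g' ≫ L.plug) : g = g' := by
  rw [← L.curry_uniq g, h, L.curry_uniq]

lemma RightResidual.hom_ext {Z Y X : C} (L : RightResidual Z Y) {g g' : X ⟶ L.obj}
    (h : g ▷ Y ≫ L.plug = g' ▷ Y ≫ L.plug) : g = g' := by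
  rw [← L.curry_uniq g, h, L.curry_uniq]

end Residuals

section Yoneda

open Opposite

variable {A : Type u₁} [Category.{v₁} A]

lemma bijective_app_homEquiv_id {φ : Aᵒᵖ ⥤ Type w} {a : A} (h : φ.RepresentableBy a)
    (ω : Aᵒᵖ ⥤ Type w) :
    Function.Bijective fun θ : φ ⟶ ω => θ.app (op a) (h.homEquiv (𝟙 a)) := by
  have app_homEquiv (θ : φ ⟶ ω) {y : A} (f : y ⟶ a) :
      θ.app (op y) (h.homEquiv f) = ω.map f.op (θ.app (op a) (h.homEquiv (𝟙 a))) := by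
    rw [h.homEquiv_eq, NatTrans.naturality_apply]
  constructor
  · intro θ θ' hθ
    ext ⟨y⟩ u
    obtain ⟨f, rfl⟩ := h.homEquiv.surjective u
    exact (app_homEquiv θ f).trans ((congrArg _ hθ).trans (app_homEquiv θ' f).symm)
  · intro u
    refine ⟨{ app y := TypeCat.ofHom fun v => ω.map (h.homEquiv.symm v).op u
              naturality := ?_ }, ?_⟩
    · intro y z g
      ext v
      have symm_map : h.homEquiv.symm (φ.map g v) = g.unop ≫ h.homEquiv.symm v :=
        (h.comp_homEquiv_symm v g.unop).symm
      simp [symm_map]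
    · simp

variable {B C : Type*} [Category* B] [Category* C]

lemma isIso_of_bijective_app_homEquiv_id {φ : Aᵒᵖ ⥤ Type w} {a : A} (h : φ.RepresentableBy a)
    {ω : Cᵒᵖ ⥤ Type w} {F : B ⥤ A ⥤ C} {ψ : Bᵒᵖ ⥤ Type _}
    (κ : ψ ⟶ pshPullback F (pshResidual φ ω))
    (hκ : ∀ x, Function.Bijective fun β =>
      NatTrans.app (F := φ) (G := pshPullback (F.obj x.unop) ω) (κ.app x β) (op a)
        (h.homEquiv (𝟙 a))) :
    IsIso κ := by
  rw [NatTrans.isIso_iff_isIso_app]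
  intro x
  rw [isIso_iff_bijective]
  exact (Function.Bijective.of_comp_iff' (bijective_app_homEquiv_id h _) (κ.app x)).1 (hκ x)

end Yoneda

section Representability

variable {D : Type u₁} [Category.{v₁} D] {T : Type u₂} [Category.{v₂} T] {t : D ⥤ T} {A : T}

/-- A refinement of `A`, seen as an object of the slice of `A`. -/
abbrev sliceOf (P : t.Fiber A) : Slice t A :=
  CostructuredArrow.mk (Y := carrier P) (eqToHom (obj_carrier P))

lemma isHomLift_iff_map_comp_eqToHom {P : t.Fiber A} {X : D} {c : t.obj X ⟶ A}
    {α : X ⟶ carrier P} : t.IsHomLift c α ↔ t.map α ≫ eqToHom (obj_carrier P) = c :=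
  ⟨fun _ => by simpa using (IsHomLift.fac t c α).symm, fun h => h ▸ inferInstance⟩

/-- The presheaf of a refinement `P` is represented by `P` itself. -/
def posRepresentableBy (P : t.Fiber A) : (posPresheaf t P).RepresentableBy (sliceOf P) where
  homEquiv :=
    { toFun f := ⟨f.left, isHomLift_iff_map_comp_eqToHom.2 (CostructuredArrow.w f)⟩
      invFun α := CostructuredArrow.homMk α.down.1 (isHomLift_iff_map_comp_eqToHom.1 α.down.2)
      left_inv _ := rfl
      right_inv _ := rfl }
  homEquiv_comp _ _ := rfl

end Representability

section Lifting

variable {D : Type u₁} [Category.{v₁} D] [MonoidalCategory D]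
  {T : Type u₂} [Category.{v₂} T] [MonoidalCategory T]
  {t : D ⥤ T} [t.Monoidal] [MonoidalRefinementSystem t]

lemma isHomLift_leftCurry {P R X : D} {A B C : T} {L : LeftResidual P R} {M : LeftResidual A C}
    (hP : t.obj P = A) (hobj : t.obj L.obj = M.obj) (hplug : t.IsHomLift M.plug L.plug)
    {c : t.obj X ⟶ B} {p : A ⊗ B ⟶ C} {f : P ⊗ X ⟶ R}
    (hf : t.IsHomLift ((δ t P X ≫ (eqToHom hP ⊗ₘ c)) ≫ p) f) :
    t.IsHomLift (c ≫ M.curry p) (L.curry f) := by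
  subst hP
  rw [eqToHom_refl] at hf
  let d : t.obj X ⟶ M.obj := t.map (L.curry f) ≫ eqToHom hobj
  have hd : t.IsHomLift d (L.curry f) := inferInstance
  have hdf : t.IsHomLift ((δ t P X ≫ (𝟙 _ ⊗ₘ d)) ≫ M.plug) f := by
    have := isHomLift_tensor t (IsHomLift.id (p := t) (a := P) rfl) hd
    rw [← L.curry_plug f, ← id_tensorHom]
    infer_instance
  have plug_d_eq : (δ t P X ≫ (𝟙 _ ⊗ₘ d)) ≫ M.plug = (δ t P X ≫ (𝟙 _ ⊗ₘ c)) ≫ p :=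
    (IsHomLift.fac t _ f).trans (IsHomLift.fac t _ f).symm
  suffices d = c ≫ M.curry p from this ▸ hd
  apply M.hom_ext
  rw [whiskerLeft_comp _ c, Category.assoc, M.curry_plug, ← cancel_epi (δ t P X)]
  simpa only [id_tensorHom, Category.assoc] using plug_d_eq

lemma isHomLift_rightCurry {R Q X : D} {A B C : T} {L : RightResidual R Q} {M : RightResidual C B}
    (hQ : t.obj Q = B) (hobj : t.obj L.obj = M.obj) (hplug : t.IsHomLift M.plug L.plug)
    {c : t.obj X ⟶ A} {p : A ⊗ B ⟶ C} {f : X ⊗ Q ⟶ R}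
    (hf : t.IsHomLift ((δ t X Q ≫ (c ⊗ₘ eqToHom hQ)) ≫ p) f) :
    t.IsHomLift (c ≫ M.curry p) (L.curry f) := by
  subst hQ
  rw [eqToHom_refl] at hf
  let d : t.obj X ⟶ M.obj := t.map (L.curry f) ≫ eqToHom hobj
  have hd : t.IsHomLift d (L.curry f) := inferInstance
  have hdf : t.IsHomLift ((δ t X Q ≫ (d ⊗ₘ 𝟙 _)) ≫ M.plug) f := by
    have := isHomLift_tensor t hd (IsHomLift.id (p := t) (a := Q) rfl)
    rw [← L.curry_plug f, ← tensorHom_id]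
    infer_instance
  have plug_d_eq : (δ t X Q ≫ (d ⊗ₘ 𝟙 _)) ≫ M.plug = (δ t X Q ≫ (c ⊗ₘ 𝟙 _)) ≫ p :=
    (IsHomLift.fac t _ f).trans (IsHomLift.fac t _ f).symm
  suffices d = c ≫ M.curry p from this ▸ hd
  apply M.hom_ext
  rw [comp_whiskerRight c, Category.assoc, M.curry_plug, ← cancel_epi (δ t X Q)]
  simpa only [tensorHom_id, Category.assoc] using plug_d_eq

end Lifting

section ImplicationsAlong

variable {D : Type u₁} [Category.{v₁} D] [MonoidalCategory D]
  {T : Type u₂} [Category.{v₂} T] [MonoidalCategory T] (t : D ⥤ T) {A B C : T}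

/-- A left residual `P ⊸ R` along `p : A ⊗ B ⟶ C`: a residual `P \ R` that lies over a residual
`A \ C`, and its pullback along the left currying `B ⟶ A \ C` of `p`. -/
structure LeftImplicationAlong (p : A ⊗ B ⟶ C) (P : t.Fiber A) (R : t.Fiber C) where
  residual : LeftResidual (carrier P) (carrier R)
  base : LeftResidual A C
  isHomLift_plug : t.IsHomLift base.plug residual.plug
  pullback : Pullback t (base.curry p) residual.obj

/-- A right residual `R ⟜ Q` along `p : A ⊗ B ⟶ C`: a residual `R / Q` that lies over a residual
`C / B`, and its pullback along the right currying `A ⟶ C / B` of `p`. -/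
structure RightImplicationAlong (p : A ⊗ B ⟶ C) (R : t.Fiber C) (Q : t.Fiber B) where
  residual : RightResidual (carrier R) (carrier Q)
  base : RightResidual C B
  isHomLift_plug : t.IsHomLift base.plug residual.plug
  pullback : Pullback t (base.curry p) residual.obj

variable [t.Monoidal]

/-- The tensor product of slices along `p : A ⊗ B ⟶ C`, sending `((X, c), (Y, d))` to
`(X ⊗ Y, (c ⊗ d) ≫ p)`. -/
abbrev tensorAlong (p : A ⊗ B ⟶ C) : Slice t A × Slice t B ⥤ Slice t C :=
  sliceTensor t A B ⋙ CostructuredArrow.map p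

variable {t} [MonoidalRefinementSystem t] {p : A ⊗ B ⟶ C}

namespace LeftImplicationAlong

variable {P : t.Fiber A} {R : t.Fiber C} (I : LeftImplicationAlong t p P R)

lemma isHomLift_apply {Y X : D} {d : t.obj Y ⟶ A} {c : t.obj X ⟶ B} {α : Y ⟶ carrier P}
    {β : X ⟶ carrier I.pullback.obj} (hα : t.IsHomLift d α) (hβ : t.IsHomLift c β) :
    t.IsHomLift ((δ t Y X ≫ (d ⊗ₘ c)) ≫ p)
      ((α ⊗ₘ (β ≫ I.pullback.map)) ≫ I.residual.plug) := by
  have := I.pullback.cartesian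
  have := I.isHomLift_plug
  have := isHomLift_tensor t hα (IsHomLift.comp t c (I.base.curry p) β I.pullback.map)
  have factor : (d ⊗ₘ c) ≫ p = (d ⊗ₘ (c ≫ I.base.curry p)) ≫ I.base.plug := by
    conv_lhs => rw [← I.base.curry_plug p]
    simp only [MonoidalCategory.tensorHom_def, whiskerLeft_comp, Category.assoc]
  rw [Category.assoc, factor, ← Category.assoc]
  infer_instance

/-- The canonical coercion from the presheaf of `P ⊸ R` to the residual of the presheaves of `P` and
`R`. -/
def coercion : posPresheaf t I.pullback.obj ⟶
    pshPullback (lcurry (tensorAlong t p)) (pshResidual (posPresheaf t P) (posPresheaf t R)) where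
  app x := TypeCat.ofHom fun β =>
    { app y := TypeCat.ofHom fun α => ⟨_, I.isHomLift_apply α.down.2 β.down.2⟩
      naturality y z f := by
        ext α
        apply ULift.ext
        apply Subtype.ext
        change ((f.unop.left ≫ α.down.1) ⊗ₘ (β.down.1 ≫ I.pullback.map)) ≫ _ =
          (f.unop.left ⊗ₘ 𝟙 x.unop.left) ≫ (α.down.1 ⊗ₘ (β.down.1 ≫ I.pullback.map)) ≫ _
        rw [tensorHom_comp_tensorHom_assoc, Category.id_comp] }
  naturality x z f := by
    ext β
    apply NatTrans.ext
    ext y α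
    apply ULift.ext
    apply Subtype.ext
    change (α.down.1 ⊗ₘ ((f.unop.left ≫ β.down.1) ≫ I.pullback.map)) ≫ _ =
      (𝟙 y.unop.left ⊗ₘ f.unop.left) ≫ (α.down.1 ⊗ₘ (β.down.1 ≫ I.pullback.map)) ≫ _
    rw [tensorHom_comp_tensorHom_assoc, Category.id_comp, Category.assoc]

lemma existsUnique_lift {X : D} {c : t.obj X ⟶ B} {f : carrier P ⊗ X ⟶ carrier R}
    (hf : t.IsHomLift ((δ t (carrier P) X ≫ (eqToHom (obj_carrier P) ⊗ₘ c)) ≫ p) f) :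
    ∃! β : X ⟶ carrier I.pullback.obj, t.IsHomLift c β ∧
      carrier P ◁ (β ≫ I.pullback.map) ≫ I.residual.plug = f := by
  have := I.pullback.cartesian
  have hobj := IsHomLift.codomain_eq t (I.base.curry p) I.pullback.map
  have := isHomLift_leftCurry (obj_carrier P) hobj I.isHomLift_plug hf
  have plug_eq_iff (g : X ⟶ I.residual.obj) :
      carrier P ◁ g ≫ I.residual.plug = f ↔ g = I.residual.curry f :=
    ⟨fun h => h ▸ (I.residual.curry_uniq g).symm, fun h => h ▸ I.residual.curry_plug f⟩
  simp only [plug_eq_iff]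
  exact Functor.IsStronglyCartesian.universal_property t (I.base.curry p) I.pullback.map c _ rfl _

instance isIso_coercion : IsIso I.coercion := by
  refine isIso_of_bijective_app_homEquiv_id (posRepresentableBy P) _ fun x => ?_
  rw [Function.bijective_iff_existsUnique]
  rintro ⟨f, hf⟩
  obtain ⟨β, ⟨hβ, hβf⟩, uniq⟩ := I.existsUnique_lift hf
  rw [← id_tensorHom] at hβf
  refine ⟨⟨β, hβ⟩, ULift.ext _ _ (Subtype.ext hβf), fun β' hβ' => ?_⟩
  refine ULift.ext _ _ (Subtype.ext (uniq _ ⟨β'.down.2, ?_⟩))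
  rw [← id_tensorHom]
  exact congrArg (·.down.1) hβ'

end LeftImplicationAlong

namespace RightImplicationAlong

variable {R : t.Fiber C} {Q : t.Fiber B} (I : RightImplicationAlong t p R Q)

lemma isHomLift_apply {X Y : D} {c : t.obj X ⟶ A} {d : t.obj Y ⟶ B}
    {β : X ⟶ carrier I.pullback.obj} {α : Y ⟶ carrier Q} (hβ : t.IsHomLift c β)
    (hα : t.IsHomLift d α) :
    t.IsHomLift ((δ t X Y ≫ (c ⊗ₘ d)) ≫ p)
      (((β ≫ I.pullback.map) ⊗ₘ α) ≫ I.residual.plug) := by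
  have := I.pullback.cartesian
  have := I.isHomLift_plug
  have := isHomLift_tensor t (IsHomLift.comp t c (I.base.curry p) β I.pullback.map) hα
  have factor : (c ⊗ₘ d) ≫ p = ((c ≫ I.base.curry p) ⊗ₘ d) ≫ I.base.plug := by
    conv_lhs => rw [← I.base.curry_plug p]
    simp only [MonoidalCategory.tensorHom_def', comp_whiskerRight, Category.assoc]
  rw [Category.assoc, factor, ← Category.assoc]
  infer_instance

/-- The canonical coercion from the presheaf of `R ⟜ Q` to the residual of the presheaves of `R` and
`Q`. -/
def coercion : posPresheaf t I.pullback.obj ⟶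
    pshPullback (rcurry (tensorAlong t p)) (pshResidual (posPresheaf t Q) (posPresheaf t R)) where
  app x := TypeCat.ofHom fun β =>
    { app y := TypeCat.ofHom fun α => ⟨_, I.isHomLift_apply β.down.2 α.down.2⟩
      naturality y z f := by
        ext α
        apply ULift.ext
        apply Subtype.ext
        change ((β.down.1 ≫ I.pullback.map) ⊗ₘ (f.unop.left ≫ α.down.1)) ≫ _ =
          (𝟙 x.unop.left ⊗ₘ f.unop.left) ≫ ((β.down.1 ≫ I.pullback.map) ⊗ₘ α.down.1) ≫ _
        rw [tensorHom_comp_tensorHom_assoc, Category.id_comp] }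
  naturality x z f := by
    ext β
    apply NatTrans.ext
    ext y α
    apply ULift.ext
    apply Subtype.ext
    change (((f.unop.left ≫ β.down.1) ≫ I.pullback.map) ⊗ₘ α.down.1) ≫ _ =
      (f.unop.left ⊗ₘ 𝟙 y.unop.left) ≫ ((β.down.1 ≫ I.pullback.map) ⊗ₘ α.down.1) ≫ _
    rw [tensorHom_comp_tensorHom_assoc, Category.id_comp, Category.assoc]

lemma existsUnique_lift {X : D} {c : t.obj X ⟶ A} {f : X ⊗ carrier Q ⟶ carrier R}
    (hf : t.IsHomLift ((δ t X (carrier Q) ≫ (c ⊗ₘ eqToHom (obj_carrier Q))) ≫ p) f) :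
    ∃! β : X ⟶ carrier I.pullback.obj, t.IsHomLift c β ∧
      (β ≫ I.pullback.map) ▷ carrier Q ≫ I.residual.plug = f := by
  have := I.pullback.cartesian
  have hobj := IsHomLift.codomain_eq t (I.base.curry p) I.pullback.map
  have := isHomLift_rightCurry (obj_carrier Q) hobj I.isHomLift_plug hf
  have plug_eq_iff (g : X ⟶ I.residual.obj) :
      g ▷ carrier Q ≫ I.residual.plug = f ↔ g = I.residual.curry f :=
    ⟨fun h => h ▸ (I.residual.curry_uniq g).symm, fun h => h ▸ I.residual.curry_plug f⟩
  simp only [plug_eq_iff]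
  exact Functor.IsStronglyCartesian.universal_property t (I.base.curry p) I.pullback.map c _ rfl _

instance isIso_coercion : IsIso I.coercion := by
  refine isIso_of_bijective_app_homEquiv_id (posRepresentableBy Q) _ fun x => ?_
  rw [Function.bijective_iff_existsUnique]
  rintro ⟨f, hf⟩
  obtain ⟨β, ⟨hβ, hβf⟩, uniq⟩ := I.existsUnique_lift hf
  rw [← tensorHom_id] at hβf
  refine ⟨⟨β, hβ⟩, ULift.ext _ _ (Subtype.ext hβf), fun β' hβ' => ?_⟩
  refine ULift.ext _ _ (Subtype.ext (uniq _ ⟨β'.down.2, ?_⟩))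
  rw [← tensorHom_id]
  exact congrArg (·.down.1) hβ'

end RightImplicationAlong

end ImplicationsAlong

section Monoids

variable {D : Type u₁} [Category.{v₁} D] [MonoidalCategory D]
  {T : Type u₂} [Category.{v₂} T] [MonoidalCategory T]
  {t : D ⥤ T} [t.Monoidal] [PartialResiduation D] [PartialResiduation T]
  [LogicalRefinementSystem t] {W : T} [MonObj W]

/-- An implication over a monoid is an implication along its multiplication. -/
def LeftImplication.alongMul {P R : t.Fiber W} (I : LeftImplication t P R) :
    LeftImplicationAlong t (MonObj.mul : W ⊗ W ⟶ W) P R where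
  residual := PartialResiduation.left I.hasLeft
  base := PartialResiduation.left
    (hasLeft_of_refines t (obj_carrier P) (obj_carrier R) I.hasLeft)
  isHomLift_plug := isHomLift_leftPlug t (obj_carrier P) (obj_carrier R) I.hasLeft
  pullback := I.pullback

/-- An implication over a monoid is an implication along its multiplication. -/
def RightImplication.alongMul {R Q : t.Fiber W} (I : RightImplication t R Q) :
    RightImplicationAlong t (MonObj.mul : W ⊗ W ⟶ W) R Q where
  residual := PartialResiduation.right I.hasRight
  base := PartialResiduation.right
    (hasRight_of_refines t (obj_carrier R) (obj_carrier Q) I.hasRight)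
  isHomLift_plug := isHomLift_rightPlug t (obj_carrier R) (obj_carrier Q) I.hasRight
  pullback := I.pullback

end Monoids

end Refinement

theorem mainTheorem9_general {D : Type u₁} [Category.{v₁} D] [MonoidalCategory D]
    {T : Type u₂} [Category.{v₂} T] [MonoidalCategory T]
    (t : D ⥤ T) [t.Monoidal] [Refinement.MonoidalRefinementSystem t]
    {A B C : T} (p : A ⊗ B ⟶ C) :
    (∀ (P : t.Fiber A) (R : t.Fiber C) (I : Refinement.LeftImplicationAlong t p P R),
      IsIso I.coercion) ∧
    (∀ (R : t.Fiber C) (Q : t.Fiber B) (I : Refinement.RightImplicationAlong t p R Q),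
      IsIso I.coercion) :=
  ⟨fun _ _ I => I.isIso_coercion, fun _ _ I => I.isIso_coercion⟩

theorem mainTheorem9 {D : Type u₁} [Category.{v₁} D] [MonoidalCategory D]
    {T : Type u₂} [Category.{v₂} T] [MonoidalCategory T]
    [Refinement.PartialResiduation D] [Refinement.PartialResiduation T]
    (t : D ⥤ T) [t.Monoidal] [Refinement.LogicalRefinementSystem t] (W : T) [MonObj W] :
    (∀ (P R : t.Fiber W) (I : Refinement.LeftImplication t P R), IsIso I.coercion) ∧
    (∀ (R Q : t.Fiber W) (I : Refinement.RightImplication t R Q), IsIso I.coercion) :=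
  have h := mainTheorem9_general t (MonObj.mul : W ⊗ W ⟶ W)
  ⟨fun P R I => h.1 P R I.alongMul, fun R Q I => h.2 R Q I.alongMul⟩
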